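/- Let $n\ge 2$ and $0\le a<1$. Let $u\in C^2(\mathbb{R}^n)$ be everywhere positive, $u>0$, and a solution of $$\operatorname{div}\bigl(|x_n|^a\nabla u\bigr)=0\quad\text{in }\mathbb{R}^n,$$ where the equation is understood classically at every point with $x_n\ne 0$ (the weight $|x_n|^a$ need not be differentiable on the hyperplane $\{x_n=0\}$; for $u\in C^2(\mathbb{R}^n)$ this is equivalent to the equation holding on all of $\mathbb{R}^n$ in the sense of distributions). Then $u$ is a constant function. -/

import Mathlib

/-- The divergence `∑ i, ∂ F i / ∂ x i` of a vector field on Euclidean space `ℝⁿ`. It is the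
classical divergence at every point where `F` is differentiable. -/
noncomputable def euclideanDivergence {n : ℕ}
    (F : EuclideanSpace ℝ (Fin n) → EuclideanSpace ℝ (Fin n))
    (x : EuclideanSpace ℝ (Fin n)) : ℝ :=
  ∑ i : Fin n, fderiv ℝ F x (EuclideanSpace.single i 1) i

/-- The vector field `y ↦ |y k|ᵃ ∇u(y)` on `ℝⁿ`, where `k` is a fixed coordinate. -/
noncomputable def weightedGradient {n : ℕ} (k : Fin n) (a : ℝ)
    (u : EuclideanSpace ℝ (Fin n) → ℝ) (y : EuclideanSpace ℝ (Fin n)) :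
    EuclideanSpace ℝ (Fin n) :=
  (|y k| ^ a) • gradient u y

/-- `u` is a `C²` solution of `div (|x k|ᵃ ∇u) = 0` in `ℝⁿ`.

The weight is not differentiable on the hyperplane `x k = 0` when `0 < a < 1`, so the classical
equation is imposed at the points off that hyperplane, where the field `|x k|ᵃ ∇u` is `C¹`.
For `u` of class `C²` on all of `ℝⁿ` and `0 ≤ a < 1` nothing is lost by this. If `a = 0`,
the equation extends to the hyperplane by continuity of the second derivatives. If `0 < a`, then
off the hyperplane it reads `Δu + a (x k)⁻¹ ∂ₖu = 0`, so that `∂ₖu = 0` on the hyperplane and the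
field `|x k|ᵃ ∂ₖu` is `O(|x k|^(1 + a))` locally; hence the equation also holds on the hyperplane
pointwise (with partial derivatives), and it holds on `ℝⁿ` in the sense of distributions.
Conversely, each of these readings gives the equation off the hyperplane. -/
structure IsC2WeightedSolution {n : ℕ} (k : Fin n) (a : ℝ)
    (u : EuclideanSpace ℝ (Fin n) → ℝ) : Prop where
  contDiff : ContDiff ℝ 2 u
  div_eq_zero : ∀ x : EuclideanSpace ℝ (Fin n), x k ≠ 0 →
    euclideanDivergence (weightedGradient k a u) x = 0

/-! Let `w` be a continuous weight, homogeneous of degree `a`, with `div (w ∇u) = 0`, and let `x₀`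
be a translation preserving `w`. Integration by parts against `(1 - |z|²)₊ᵐ` shows that weighted
averages of `u` about `x₀` do not depend on the scale (`integral_dilation_eq`). With radius `√(m/s)`
and `m → ∞` the kernels become Gaussians; since `u > 0`, Fatou gives integrability without any
growth assumption, and hence a Gaussian mean value property (`IsWeightedHarmonic.gaussian_mean`). A
slightly narrower Gaussian about `x` is dominated by a multiple of one about `y`; letting both
become flat yields `u x ≤ u y` (`IsWeightedHarmonic.le_of_invariant`). So `u` is constant on the set
of invariant translations.

For `a = 0` the weight is `1` and this set is the whole space. For `a > 0` it is only the
hyperplane. There the equation forces `∂ₖu = 0`, so the weight may be cut off to one side, `(σ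
zₖ)₊ᵃ`, without destroying the equation. If `c` is the value of `u` on the hyperplane, then `u w`
and `c w` have the same integrals against every Gaussian centred on it. On a half space such
Gaussians separate points, so by Stone-Weierstrass they determine a finite measure
(`measure_halfSpace_ext`), and `u = c` on each side. -/

open MeasureTheory Filter Topology Set BoundedContinuousFunction

/-! ### Mean value property for compactly supported radial kernels. -/

section

/-- The Euclidean space `ℝⁿ`. -/
abbrev Eucl (n : ℕ) := EuclideanSpace ℝ (Fin n)

/-- A continuous nonnegative weight, nonzero and homogeneous of degree `a`. -/
structure IsHomogeneousWeight {n : ℕ} (a : ℝ) (w : Eucl n → ℝ) : Prop where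
  continuous : Continuous w
  nonneg : ∀ z, 0 ≤ w z
  smul : ∀ t : ℝ, 0 < t → ∀ z, w (t • z) = t ^ a * w z
  le_norm : ∀ z, w z ≤ 1 + ‖z‖ ^ 2
  exists_pos : ∃ z, 0 < w z

/-- `u` is `C¹` and solves `div (w ∇u) = 0` everywhere, the partial derivatives in the
divergence being continuous. -/
structure IsWeightedHarmonic {n : ℕ} (w u : Eucl n → ℝ) : Prop where
  contDiff : ContDiff ℝ 1 u
  exists_div : ∃ d : Fin n → Eucl n → ℝ, (∀ i, Continuous (d i)) ∧
    (∀ i z, HasLineDerivAt ℝ (fun y => w y * fderiv ℝ u y (EuclideanSpace.single i 1)) (d i z) z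
      (EuclideanSpace.single i 1)) ∧ ∀ z, ∑ i, d i z = 0

/-- As `g x = 0`, the slope of the product is `f y` times the slope of `g`, so continuity of `f`
suffices. This covers points where the weight is not differentiable. -/
lemma hasDerivAt_mul_of_eq_zero {f g : ℝ → ℝ} {g' x : ℝ} (hf : ContinuousAt f x)
    (hg : HasDerivAt g g' x) (h0 : g x = 0) : HasDerivAt (fun y => f y * g y) (f x * g') x := by
  rw [hasDerivAt_iff_tendsto_slope] at hg ⊢
  have := (hf.tendsto.mono_left (nhdsWithin_le_nhds (s := {x}ᶜ))).mul hg
  refine this.congr fun y => ?_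
  simp only [slope_def_field, h0]
  ring

lemma hasDerivAt_posPart_pow {m : ℕ} (hm : 1 ≤ m) (s : ℝ) :
    HasDerivAt (fun x : ℝ => (max x 0) ^ (m + 1)) ((m + 1) * (max s 0) ^ m) s := by
  rcases lt_trichotomy s 0 with h | h | h
  · rw [max_eq_right h.le, zero_pow (by omega), mul_zero]
    refine (hasDerivAt_const s (0 : ℝ)).congr_of_eventuallyEq ?_
    filter_upwards [gt_mem_nhds h] with x hx
    rw [max_eq_right hx.le, zero_pow (by omega)]
  · subst h
    have := hasDerivAt_mul_of_eq_zero (f := fun x : ℝ => (max x 0) ^ m) (x := 0)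
      (by fun_prop) (hasDerivAt_id (0 : ℝ)) rfl
    rw [max_self, zero_pow (show m ≠ 0 by omega), mul_zero]
    rw [max_self, zero_pow (show m ≠ 0 by omega), zero_mul] at this
    refine this.congr_of_eventuallyEq (Eventually.of_forall fun x => ?_)
    rcases le_total x 0 with hx | hx
    · simp [max_eq_right hx, show m ≠ 0 by omega]
    · simp [max_eq_left hx, pow_succ]
  · have := hasDerivAt_pow (m + 1) s
    rw [max_eq_left h.le]
    push_cast at this
    refine this.congr_of_eventuallyEq ?_
    filter_upwards [lt_mem_nhds h] with x hx
    rw [max_eq_left hx.le]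

/-- The compactly supported radial kernel `(1 - |z|²)₊ᵐ`. -/
noncomputable def bump {n : ℕ} (m : ℕ) (z : Eucl n) : ℝ := (max (1 - ‖z‖ ^ 2) 0) ^ m

lemma continuous_bump {n : ℕ} (m : ℕ) : Continuous (bump m : Eucl n → ℝ) := by
  unfold bump; fun_prop

lemma bump_eq_zero {n m : ℕ} (hm : 1 ≤ m) {z : Eucl n} (hz : 1 ≤ ‖z‖) : bump m z = 0 := by
  unfold bump
  rw [max_eq_right (by nlinarith), zero_pow (by omega)]

lemma hasCompactSupport_bump {n m : ℕ} (hm : 1 ≤ m) :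
    HasCompactSupport (bump m : Eucl n → ℝ) := by
  refine HasCompactSupport.intro (isCompact_closedBall (0 : Eucl n) 1) fun z hz => ?_
  refine bump_eq_zero hm ?_
  simpa using (not_le.1 (by simpa using hz)).le

/-- Up to a constant, `z * bump m z` is a gradient; this is what lets the radial derivative of `u`
be integrated by parts. -/
lemma hasLineDerivAt_bump {n m : ℕ} (hm : 1 ≤ m) (z : Eucl n) (i : Fin n) :
    HasLineDerivAt ℝ (bump (m + 1)) (-(2 * (m + 1)) * (z i * bump m z)) z
      (EuclideanSpace.single i 1) := by
  have h1 : HasFDerivAt (fun y : Eucl n => 1 - ‖y‖ ^ 2) (-(2 • innerSL ℝ z)) z :=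
    (hasStrictFDerivAt_norm_sq z).hasFDerivAt.const_sub 1
  have h2 := (hasDerivAt_posPart_pow hm (1 - ‖z‖ ^ 2)).comp_hasFDerivAt z h1
  have h3 := h2.hasLineDerivAt (EuclideanSpace.single i 1)
  have e : -(2 * (m + 1)) * (z i * bump m z) =
      (((m + 1 : ℝ) * (max (1 - ‖z‖ ^ 2) 0) ^ m) • (-(2 • innerSL ℝ z)))
        (EuclideanSpace.single i 1) := by
    simp [bump, EuclideanSpace.inner_single_right]
    ring
  rw [e]
  exact h3

lemma sum_single_coord {n : ℕ} (z : Eucl n) :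
    ∑ i, z i • (EuclideanSpace.single i (1 : ℝ) : Eucl n) = z := by
  ext j
  simp [Finset.sum_apply, Pi.single_apply]

variable {n : ℕ} {a : ℝ} {w u : Eucl n → ℝ}

/-- The integrand is a multiple of `w ∇u(x₀ + t z) · ∇(bump (m + 1))`, and the rescaled field `w
∇u(x₀ + t ·)` is again divergence free by homogeneity and invariance of `w`. -/
lemma integral_radial_deriv_eq_zero (hw : IsHomogeneousWeight a w) (hu : IsWeightedHarmonic w u)
    {x₀ : Eucl n} (hx : ∀ z, w (x₀ + z) = w z) {t : ℝ} (ht : 0 < t) {m : ℕ} (hm : 1 ≤ m) :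
    ∫ z, fderiv ℝ u (x₀ + t • z) z * (w z * bump m z) = 0 := by
  obtain ⟨d, hdc, hd, hd0⟩ := hu.exists_div
  have hDc : Continuous (fderiv ℝ u) := hu.contDiff.continuous_fderiv one_ne_zero
  have hwc := hw.continuous
  set f : Fin n → Eucl n → ℝ := fun i z =>
    w z * fderiv ℝ u (x₀ + t • z) (EuclideanSpace.single i 1) with hf
  -- By homogeneity `f i z` is `t ^ (-a)` times the field `w ∂ᵢu` at `x₀ + t • z`; the chain rule
  -- supplies one more factor `t`.
  set f' : Fin n → Eucl n → ℝ := fun i z => t ^ (1 - a) * d i (x₀ + t • z) with hf'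
  have hfc : ∀ i, Continuous (f i) := fun i => by
    have : Continuous fun z => fderiv ℝ u (x₀ + t • z) := hDc.comp (by fun_prop)
    exact hwc.mul (this.clm_apply continuous_const)
  have hfc' : ∀ i, Continuous (f' i) := fun i => by
    exact continuous_const.mul ((hdc i).comp (by fun_prop))
  have hfd : ∀ i z, HasLineDerivAt ℝ (f i) (f' i z) z (EuclideanSpace.single i 1) := by
    intro i z
    have h := hd i (x₀ + t • z)
    unfold HasLineDerivAt at h ⊢
    have h1 : HasDerivAt (fun s : ℝ => t * s) t 0 := by
      simpa using (hasDerivAt_id (0 : ℝ)).const_mul t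
    have h2 := (HasDerivAt.comp (0 : ℝ) (by simpa using h) h1).const_mul (t ^ (-a))
    have e1 : t ^ (1 - a) = t ^ (-a) * t := by
      rw [sub_eq_neg_add, Real.rpow_add ht, Real.rpow_one]
    have e3 : t ^ (-a) * (d i (x₀ + t • z) * t) = f' i z := by
      simp only [hf', e1]; ring
    rw [e3] at h2
    refine h2.congr_of_eventuallyEq (Eventually.of_forall fun s => ?_)
    · have e2 : x₀ + t • z + (t * s) • EuclideanSpace.single i (1 : ℝ)
          = x₀ + t • (z + s • EuclideanSpace.single i (1 : ℝ)) := by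
        rw [smul_add, smul_smul, add_assoc]
      simp only [hf, Function.comp, e2, hx, hw.smul t ht]
      rw [← mul_assoc, ← mul_assoc, ← Real.rpow_add ht]
      simp
  have hcs := hasCompactSupport_bump (n := n) hm
  have hcs1 := hasCompactSupport_bump (n := n) (m := m + 1) (by omega)
  have hbc := continuous_bump (n := n) m
  have hbc1 := continuous_bump (n := n) (m + 1)
  have key : ∀ i, ∫ z, f i z * (-(2 * (m + 1)) * (z i * bump m z))
      = - ∫ z, f' i z * bump (m + 1) z := by
    intro i
    refine integral_bilinear_hasLineDerivAt_right_eq_neg_left_of_integrable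
      (B := ContinuousLinearMap.mul ℝ ℝ) (v := EuclideanSpace.single i 1) ?_ ?_ ?_
      (fun z _ => hfd i z) (fun z _ => hasLineDerivAt_bump hm z i)
    · exact ((hfc' i).mul hbc1).integrable_of_hasCompactSupport hcs1.mul_left
    · refine Continuous.integrable_of_hasCompactSupport ?_ ?_
      · exact (hfc i).mul (continuous_const.mul (by fun_prop))
      · exact (hcs.mul_left.mul_left).mul_left
    · exact ((hfc i).mul hbc1).integrable_of_hasCompactSupport hcs1.mul_left
  have hsum : ∫ z, fderiv ℝ u (x₀ + t • z) z * (w z * bump m z)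
      = ∑ i, (-(2 * (m + 1) : ℝ))⁻¹ * ∫ z, f i z * (-(2 * (m + 1)) * (z i * bump m z)) := by
    simp_rw [← integral_const_mul]
    rw [← integral_finsetSum]
    · refine integral_congr_ae (Eventually.of_forall fun z => ?_)
      dsimp only
      conv_lhs => rw [show fderiv ℝ u (x₀ + t • z) z
        = fderiv ℝ u (x₀ + t • z) (∑ i, z i • (EuclideanSpace.single i (1 : ℝ) : Eucl n)) by
          rw [sum_single_coord]]
      rw [map_sum, Finset.sum_mul]
      refine Finset.sum_congr rfl fun i _ => ?_
      rw [map_smul, smul_eq_mul, hf]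
      have : (2 * (m + 1) : ℝ) ≠ 0 := by positivity
      field_simp
    · intro i _
      refine (Continuous.integrable_of_hasCompactSupport ?_ ?_).const_mul _
      · exact (hfc i).mul (continuous_const.mul (by fun_prop))
      · exact (hcs.mul_left.mul_left).mul_left
  rw [hsum]
  simp_rw [key]
  rw [← Finset.mul_sum, Finset.sum_neg_distrib, ← integral_finsetSum]
  · have : ∀ z, ∑ i, f' i z * bump (m + 1) z = 0 := fun z => by
      rw [← Finset.sum_mul, hf', ← Finset.mul_sum, hd0]; simp
    simp [this]
  · intro i _
    exact ((hfc' i).mul hbc1).integrable_of_hasCompactSupport hcs1.mul_left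

lemma hasDerivAt_integral_dilation (hwc : Continuous w) (hu : ContDiff ℝ 1 u)
    (x₀ : Eucl n) (t : ℝ) {m : ℕ} (hm : 1 ≤ m) :
    HasDerivAt (fun t => ∫ z, u (x₀ + t • z) * (w z * bump m z))
      (∫ z, fderiv ℝ u (x₀ + t • z) z * (w z * bump m z)) t := by
  have hDc : Continuous (fderiv ℝ u) := hu.continuous_fderiv one_ne_zero
  have hbc := continuous_bump (n := n) m
  have huc := hu.continuous
  have hF' : Continuous fun p : ℝ × Eucl n =>
      fderiv ℝ u (x₀ + p.1 • p.2) p.2 * (w p.2 * bump m p.2) := by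
    have h1 : Continuous fun p : ℝ × Eucl n => fderiv ℝ u (x₀ + p.1 • p.2) :=
      hDc.comp (by fun_prop)
    exact (h1.clm_apply continuous_snd).mul (by fun_prop)
  obtain ⟨C, hC⟩ := ((isCompact_closedBall t 1).prod
    (isCompact_closedBall (0 : Eucl n) 1)).exists_bound_of_continuousOn hF'.continuousOn
  have hcs := hasCompactSupport_bump (n := n) hm
  refine (hasDerivAt_integral_of_dominated_loc_of_deriv_le
    (F' := fun t z => fderiv ℝ u (x₀ + t • z) z * (w z * bump m z))
    (s := Metric.closedBall t 1) (bound := (Metric.closedBall (0 : Eucl n) 1).indicator fun _ => C)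
    (Metric.closedBall_mem_nhds t one_pos) ?_ ?_ ?_ ?_ ?_ ?_).2
  · exact Eventually.of_forall fun s => (by fun_prop : Continuous _).aestronglyMeasurable
  · refine Continuous.integrable_of_hasCompactSupport (by fun_prop) hcs.mul_left.mul_left
  · exact (hF'.comp (by fun_prop : Continuous fun z : Eucl n => (t, z))).aestronglyMeasurable
  · refine Eventually.of_forall fun z s hs => ?_
    by_cases hz : z ∈ Metric.closedBall (0 : Eucl n) 1
    · rw [indicator_of_mem hz]; exact hC (s, z) ⟨hs, hz⟩
    · rw [indicator_of_notMem hz, bump_eq_zero hm]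
      · simp
      · simpa using (not_le.1 (by simpa using hz)).le
  · exact (integrable_indicator_iff measurableSet_closedBall).2
      (integrableOn_const (measure_closedBall_lt_top.ne))
  · refine Eventually.of_forall fun z s _ => ?_
    have h1 : HasDerivAt (fun s : ℝ => x₀ + s • z) z s := by
      simpa using ((hasDerivAt_id s).smul_const z).const_add x₀
    exact (((hu.differentiable one_ne_zero) _).hasFDerivAt.comp_hasDerivAt s h1).mul_const _

/-- The average has zero derivative at positive scales and is continuous at scale `0`, where it
gives the right-hand side; the mean value theorem on `[0, t]` needs no more. -/
lemma integral_dilation_eq (hw : IsHomogeneousWeight a w) (hu : IsWeightedHarmonic w u)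
    {x₀ : Eucl n} (hx : ∀ z, w (x₀ + z) = w z) {t : ℝ} (ht : 0 < t) {m : ℕ} (hm : 1 ≤ m) :
    ∫ z, u (x₀ + t • z) * (w z * bump m z) = ∫ z, u x₀ * (w z * bump m z) := by
  have hd := fun s => hasDerivAt_integral_dilation hw.continuous hu.contDiff x₀ s hm
  obtain ⟨c, hc, h⟩ := exists_hasDerivAt_eq_slope _ _ ht
    (fun s _ => (hd s).continuousAt.continuousWithinAt) (fun s _ => hd s)
  rw [integral_radial_deriv_eq_zero hw hu hx hc.1 hm, eq_comm, div_eq_zero_iff] at h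
  rcases h with h | h
  · simpa using sub_eq_zero.1 h
  · linarith

lemma integral_sub_mul_bump_eq_zero (hw : IsHomogeneousWeight a w) (hu : IsWeightedHarmonic w u)
    {x₀ : Eucl n} (hx : ∀ z, w (x₀ + z) = w z) {t : ℝ} (ht : 0 < t) {m : ℕ} (hm : 1 ≤ m) :
    ∫ y, (u y - u x₀) * (w y * bump m (t⁻¹ • (y - x₀))) = 0 := by
  have hwc := hw.continuous
  have huc := hu.contDiff.continuous
  have hbc := continuous_bump (n := n) m
  have hcs := hasCompactSupport_bump (n := n) hm
  set F : Eucl n → ℝ := fun y => (u y - u x₀) * (w y * bump m (t⁻¹ • (y - x₀))) with hF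
  have h1 : ∫ z, F (x₀ + t • z) = 0 := by
    have : ∀ z, F (x₀ + t • z) =
        t ^ a * (u (x₀ + t • z) * (w z * bump m z) - u x₀ * (w z * bump m z)) := by
      intro z
      simp only [hF, hx, hw.smul t ht, add_sub_cancel_left, smul_smul, inv_mul_cancel₀ ht.ne',
        one_smul]
      ring
    simp_rw [this]
    rw [integral_const_mul, integral_sub, integral_dilation_eq hw hu hx ht hm]
    · simp
    · exact Continuous.integrable_of_hasCompactSupport (by fun_prop) hcs.mul_left.mul_left
    · exact Continuous.integrable_of_hasCompactSupport (by fun_prop) hcs.mul_left.mul_left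
  rw [Measure.integral_comp_smul volume (fun z => F (x₀ + z)) t,
    integral_add_left_eq_self F x₀, smul_eq_mul, mul_eq_zero] at h1
  refine h1.resolve_left ?_
  positivity

end

/-! ### Passage to Gaussian kernels, and comparison of two centres. -/

section

/-- Fatou's lemma. It replaces a growth bound on `u`: positivity and bounded averages are enough. -/
lemma integrable_of_tendsto_of_integral_le {α : Type*} [MeasurableSpace α] {μ : Measure α}
    {F : ℕ → α → ℝ} {f : α → ℝ} {M : ℝ} (hF0 : ∀ m x, 0 ≤ F m x) (hF : ∀ m, Integrable (F m) μ)
    (hM : ∀ m, ∫ x, F m x ∂μ ≤ M) (hf : ∀ x, Tendsto (fun m => F m x) atTop (𝓝 (f x))) :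
    Integrable f μ := by
  have hf0 : ∀ x, 0 ≤ f x := fun x => ge_of_tendsto' (hf x) fun m => hF0 m x
  refine ⟨aestronglyMeasurable_of_tendsto_ae atTop (fun m => (hF m).aestronglyMeasurable)
    (Eventually.of_forall hf), ?_⟩
  rw [hasFiniteIntegral_iff_ofReal (Eventually.of_forall hf0)]
  have h1 : ∫⁻ x, ENNReal.ofReal (f x) ∂μ =
      ∫⁻ x, liminf (fun m => ENNReal.ofReal (F m x)) atTop ∂μ :=
    lintegral_congr fun x => (((ENNReal.continuous_ofReal.tendsto _).comp (hf x)).liminf_eq).symm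
  rw [h1]
  refine (lintegral_liminf_le' fun m =>
    (hF m).aestronglyMeasurable.aemeasurable.ennreal_ofReal).trans_lt ?_
  refine lt_of_le_of_lt (b := ENNReal.ofReal M) ?_ ENNReal.ofReal_lt_top
  refine liminf_le_of_le (by isBoundedDefault) fun b hb => ?_
  obtain ⟨m, hm⟩ := hb.exists
  refine hm.trans ?_
  rw [← ofReal_integral_eq_lintegral_ofReal (hF m) (Eventually.of_forall (hF0 m))]
  exact ENNReal.ofReal_le_ofReal (hM m)

lemma posPart_one_sub_div_pow_le {m : ℕ} (hm : 1 ≤ m) (q : ℝ) :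
    (max (1 - q / m) 0) ^ m ≤ Real.exp (-q) := by
  have hm' : (0 : ℝ) < m := by exact_mod_cast hm
  rcases le_total q m with h | h
  · rw [max_eq_left (by rw [sub_nonneg, div_le_one hm']; exact h)]
    exact Real.one_sub_div_pow_le_exp_neg h
  · rw [max_eq_right (by rw [sub_nonpos, one_le_div hm']; exact h), zero_pow (by omega)]
    positivity

lemma tendsto_posPart_one_sub_div_pow (q : ℝ) :
    Tendsto (fun m : ℕ => (max (1 - q / m) 0) ^ m) atTop (𝓝 (Real.exp (-q))) := by
  refine (Real.tendsto_one_add_div_pow_exp (-q)).congr' ?_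
  filter_upwards [eventually_ge_atTop (max 1 ⌈q⌉₊)] with m hm
  have hm' : (0 : ℝ) < m := by exact_mod_cast (le_max_left _ _).trans hm
  have hq : q ≤ m := (Nat.le_ceil q).trans (by exact_mod_cast (le_max_right _ _).trans hm)
  rw [max_eq_left (by rw [sub_nonneg, div_le_one hm']; exact hq), neg_div, sub_eq_add_neg]

/-- The radius `√(m / s)` is the one for which the kernels tend to `exp (-s |z|²)`. -/
lemma bump_scaled {n m : ℕ} (hm : 1 ≤ m) {s : ℝ} (hs : 0 < s) (z : Eucl n) :
    bump m ((√(m / s))⁻¹ • z) = (max (1 - s * ‖z‖ ^ 2 / m) 0) ^ m := by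
  have hm' : (0 : ℝ) < m := by exact_mod_cast hm
  unfold bump
  rw [norm_smul, mul_pow, norm_inv, inv_pow, Real.norm_eq_abs, sq_abs, Real.sq_sqrt (by positivity)]
  congr 3
  field_simp

lemma integrable_exp_neg_mul_norm_sq {n : ℕ} {s : ℝ} (hs : 0 < s) :
    Integrable fun z : Eucl n => Real.exp (-s * ‖z‖ ^ 2) := by
  have := (GaussianFourier.integrable_cexp_neg_mul_sq_norm_add (V := Eucl n) (b := (s : ℂ))
    (by simpa using hs) 0 0).re
  refine this.congr (Eventually.of_forall fun z => ?_)
  have : (-(s : ℂ) * (‖z‖ : ℂ) ^ 2 + 0 * (inner ℝ (0 : Eucl n) z : ℝ)) =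
    ((-s * ‖z‖ ^ 2 : ℝ) : ℂ) := by push_cast; ring
  simp only [this, ← Complex.ofReal_exp]
  rfl

variable {n : ℕ} {a : ℝ} {w u : Eucl n → ℝ}

lemma IsHomogeneousWeight.integrable_mul_gaussian_zero (hw : IsHomogeneousWeight a w)
    {s : ℝ} (hs : 0 < s) : Integrable fun z => w z * Real.exp (-s * ‖z‖ ^ 2) := by
  have hwc := hw.continuous
  refine ((integrable_exp_neg_mul_norm_sq (n := n) (half_pos hs)).const_mul (1 + 2 / s)).mono'
    (by fun_prop : Continuous _).aestronglyMeasurable (Eventually.of_forall fun z => ?_)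
  rw [Real.norm_of_nonneg (mul_nonneg (hw.nonneg z) (Real.exp_pos _).le)]
  have h1 := hw.le_norm z
  have h2 := Real.add_one_le_exp (s / 2 * ‖z‖ ^ 2)
  have h3 : 1 + ‖z‖ ^ 2 ≤ (1 + 2 / s) * Real.exp (s / 2 * ‖z‖ ^ 2) := by
    refine le_trans ?_ (mul_le_mul_of_nonneg_left h2 (by positivity))
    have : (1 + 2 / s) * (s / 2 * ‖z‖ ^ 2 + 1)
      = 1 + ‖z‖ ^ 2 + (s / 2 * ‖z‖ ^ 2 + 2 / s) := by field_simp; ring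
    rw [this]
    have : 0 ≤ s / 2 * ‖z‖ ^ 2 + 2 / s := by positivity
    linarith
  calc w z * Real.exp (-s * ‖z‖ ^ 2)
      ≤ (1 + 2 / s) * Real.exp (s / 2 * ‖z‖ ^ 2) * Real.exp (-s * ‖z‖ ^ 2) := by
        gcongr; exact h1.trans h3
    _ = (1 + 2 / s) * Real.exp (-(s / 2) * ‖z‖ ^ 2) := by
        rw [mul_assoc, ← Real.exp_add]; ring_nf

lemma weight_sub_eq {x₀ : Eucl n} (hx : ∀ z, w (x₀ + z) = w z) (y : Eucl n) :
    w (y - x₀) = w y := by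
  rw [← hx (y - x₀)]; simp

lemma IsHomogeneousWeight.integrable_mul_gaussian (hw : IsHomogeneousWeight a w)
    {x₀ : Eucl n} (hx : ∀ z, w (x₀ + z) = w z) {s : ℝ} (hs : 0 < s) :
    Integrable fun y => w y * Real.exp (-s * ‖y - x₀‖ ^ 2) := by
  have := (hw.integrable_mul_gaussian_zero hs).comp_sub_right x₀
  simpa only [weight_sub_eq hx] using this

lemma integral_weight_mul_gaussian {x₀ : Eucl n} (hx : ∀ z, w (x₀ + z) = w z) (s : ℝ) :
    ∫ y, w y * Real.exp (-s * ‖y - x₀‖ ^ 2) = ∫ y, w y * Real.exp (-s * ‖y‖ ^ 2) := by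
  rw [← integral_sub_right_eq_self (fun y => w y * Real.exp (-s * ‖y‖ ^ 2)) x₀]
  simp only [weight_sub_eq hx]

lemma IsHomogeneousWeight.integral_gaussian_pos (hw : IsHomogeneousWeight a w)
    {s : ℝ} (hs : 0 < s) : 0 < ∫ y, w y * Real.exp (-s * ‖y‖ ^ 2) := by
  have hwc := hw.continuous
  have hc : Continuous fun y => w y * Real.exp (-s * ‖y‖ ^ 2) := by fun_prop
  rw [integral_pos_iff_support_of_nonneg
    (fun y => mul_nonneg (hw.nonneg y) (Real.exp_pos _).le) (hw.integrable_mul_gaussian_zero hs)]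
  refine hc.isOpen_support.measure_pos volume ?_
  obtain ⟨z, hz⟩ := hw.exists_pos
  exact ⟨z, (mul_pos hz (Real.exp_pos _)).ne'⟩

lemma IsHomogeneousWeight.integral_gaussian_scale (hw : IsHomogeneousWeight a w)
    {r : ℝ} (hr : 0 < r) (s : ℝ) :
    ∫ y, w y * Real.exp (-s * ‖y‖ ^ 2) =
      r ^ n * r ^ a * ∫ y, w y * Real.exp (-(r ^ 2 * s) * ‖y‖ ^ 2) := by
  have h := Measure.integral_comp_smul volume (fun y => w y * Real.exp (-s * ‖y‖ ^ 2)) r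
  have e : ∀ y, w (r • y) * Real.exp (-s * ‖r • y‖ ^ 2) =
      r ^ a * (w y * Real.exp (-(r ^ 2 * s) * ‖y‖ ^ 2)) := fun y => by
    rw [hw.smul r hr, norm_smul, Real.norm_of_nonneg hr.le]
    ring_nf
  simp_rw [e] at h
  rw [integral_const_mul, finrank_euclideanSpace_fin, abs_of_nonneg (by positivity),
    smul_eq_mul] at h
  rw [mul_assoc, h, ← mul_assoc, mul_inv_cancel₀ (by positivity), one_mul]

/-- Gaussian mean value property of positive solutions, together with integrability. -/
theorem IsWeightedHarmonic.gaussian_mean (hw : IsHomogeneousWeight a w)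
    (hu : IsWeightedHarmonic w u) (hpos : ∀ x, 0 < u x) {x₀ : Eucl n}
    (hx : ∀ z, w (x₀ + z) = w z) {s : ℝ} (hs : 0 < s) :
    Integrable (fun y => u y * (w y * Real.exp (-s * ‖y - x₀‖ ^ 2))) ∧
    ∫ y, u y * (w y * Real.exp (-s * ‖y - x₀‖ ^ 2)) =
      u x₀ * ∫ y, w y * Real.exp (-s * ‖y‖ ^ 2) := by
  have hwc := hw.continuous
  have huc := hu.contDiff.continuous
  -- The shift to `m + 1` keeps the exponent at least `1`, so that every kernel is compactly
  -- supported.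
  set β : ℕ → Eucl n → ℝ := fun m y => (max (1 - s * ‖y - x₀‖ ^ 2 / ↑(m + 1)) 0) ^ (m + 1) with hβ
  have hβ0 : ∀ m y, 0 ≤ β m y := fun m y => by simp only [hβ]; positivity
  have hβe : ∀ m y, β m y ≤ Real.exp (-s * ‖y - x₀‖ ^ 2) := fun m y => by
    rw [neg_mul]
    exact posPart_one_sub_div_pow_le (m := m + 1) (by omega) (s * ‖y - x₀‖ ^ 2)
  have hβt : ∀ y, Tendsto (fun m => β m y) atTop (𝓝 (Real.exp (-s * ‖y - x₀‖ ^ 2))) := fun y => by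
    have := (tendsto_posPart_one_sub_div_pow (s * ‖y - x₀‖ ^ 2)).comp (tendsto_add_atTop_nat 1)
    rw [neg_mul]
    exact this
  have hβb : ∀ m y, bump (m + 1) ((√(↑(m + 1) / s))⁻¹ • (y - x₀)) = β m y := fun m y =>
    bump_scaled (by omega) hs _
  have hβc : ∀ m, Continuous (β m) := fun m => by simp only [hβ]; fun_prop
  have hβs : ∀ m, HasCompactSupport (β m) := fun m => by
    refine HasCompactSupport.intro
      (isCompact_closedBall x₀ (√(↑(m + 1) / s))) fun y hy => ?_
    have hr : 0 < √(((m + 1 : ℕ) : ℝ) / s) := Real.sqrt_pos.2 (by positivity)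
    rw [← hβb]
    refine bump_eq_zero (by omega) ?_
    rw [norm_smul, norm_inv, Real.norm_of_nonneg hr.le, ← dist_eq_norm, inv_mul_eq_div,
      one_le_div hr]
    exact (not_le.1 hy).le
  have hi1 : ∀ m, Integrable fun y => u y * (w y * β m y) := fun m => by
    have := hβc m
    exact Continuous.integrable_of_hasCompactSupport (by fun_prop) (hβs m).mul_left.mul_left
  have hi2 : ∀ m, Integrable fun y => w y * β m y := fun m => by
    have := hβc m
    exact Continuous.integrable_of_hasCompactSupport (by fun_prop) (hβs m).mul_left
  have hmean : ∀ m, ∫ y, u y * (w y * β m y) = u x₀ * ∫ y, w y * β m y := fun m => by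
    have h := integral_sub_mul_bump_eq_zero hw hu hx
      (t := √(((m + 1 : ℕ) : ℝ) / s)) (Real.sqrt_pos.2 (by positivity)) (m := m + 1) (by omega)
    simp_rw [hβb, sub_mul] at h
    rw [integral_sub (hi1 m) ((hi2 m).const_mul _), integral_const_mul] at h
    linarith
  have hgi := hw.integrable_mul_gaussian hx hs
  have hM : ∀ m, ∫ y, u y * (w y * β m y) ≤
      u x₀ * ∫ y, w y * Real.exp (-s * ‖y - x₀‖ ^ 2) := fun m => by
    rw [hmean]
    refine mul_le_mul_of_nonneg_left (integral_mono (hi2 m) hgi fun y => ?_) (hpos _).le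
    exact mul_le_mul_of_nonneg_left (hβe m y) (hw.nonneg y)
  have hint : Integrable (fun y => u y * (w y * Real.exp (-s * ‖y - x₀‖ ^ 2))) :=
    integrable_of_tendsto_of_integral_le
      (fun m y => mul_nonneg (hpos y).le (mul_nonneg (hw.nonneg y) (hβ0 m y))) hi1 hM
      fun y => ((hβt y).const_mul _).const_mul _
  refine ⟨hint, ?_⟩
  -- The limit itself, integrable by Fatou, is the dominating function, because each `β m` lies
  -- below the Gaussian.
  have l1 := tendsto_integral_of_dominated_convergence _
    (fun m => (hi1 m).aestronglyMeasurable) hint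
    (fun m => Eventually.of_forall fun y => by
      rw [Real.norm_of_nonneg
        (mul_nonneg (hpos y).le (mul_nonneg (hw.nonneg y) (hβ0 m y)))]
      exact mul_le_mul_of_nonneg_left
        (mul_le_mul_of_nonneg_left (hβe m y) (hw.nonneg y)) (hpos y).le)
    (Eventually.of_forall fun y => ((hβt y).const_mul (w y)).const_mul (u y))
  have l2 := tendsto_integral_of_dominated_convergence _
    (fun m => (hi2 m).aestronglyMeasurable) hgi
    (fun m => Eventually.of_forall fun y => by
      rw [Real.norm_of_nonneg (mul_nonneg (hw.nonneg y) (hβ0 m y))]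
      exact mul_le_mul_of_nonneg_left (hβe m y) (hw.nonneg y))
    (Eventually.of_forall fun y => (hβt y).const_mul (w y))
  simp_rw [hmean] at l1
  rw [← integral_weight_mul_gaussian hx s]
  exact tendsto_nhds_unique l1 (l2.const_mul _)

/-- Young's inequality, with the cross term `2pq` absorbed by `(r² - 1) p² + q² / (r² - 1)`. -/
lemma norm_sub_sq_le_of_one_lt {r : ℝ} (hr : 1 < r) (x y z : Eucl n) :
    ‖z - y‖ ^ 2 ≤ r ^ 2 * ‖z - x‖ ^ 2 + (1 + 1 / (r ^ 2 - 1)) * ‖x - y‖ ^ 2 := by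
  have hr' : 0 < r ^ 2 - 1 := by nlinarith
  have h1 : ‖z - y‖ ≤ ‖z - x‖ + ‖x - y‖ := norm_sub_le_norm_sub_add_norm_sub z x y
  have h2 : ‖z - y‖ ^ 2 ≤ (‖z - x‖ + ‖x - y‖) ^ 2 := pow_le_pow_left₀ (norm_nonneg _) h1 2
  generalize ‖z - x‖ = p at *
  generalize ‖x - y‖ = q at *
  refine h2.trans ?_
  have : 0 ≤ ((r ^ 2 - 1) * p - q) ^ 2 / (r ^ 2 - 1) := by positivity
  have e : ((r ^ 2 - 1) * p - q) ^ 2 / (r ^ 2 - 1)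
      = (r ^ 2 - 1) * p ^ 2 - 2 * p * q + 1 / (r ^ 2 - 1) * q ^ 2 := by
    field_simp; ring
  rw [e] at this
  linarith

/-- The Gaussian of parameter `r² s` about `x` is at most `exp (s C)` times that of parameter `s`
about `y`. The ratio of their weighted masses is `r ^ n * r ^ a` by scaling. -/
theorem IsWeightedHarmonic.le_of_invariant (hw : IsHomogeneousWeight a w)
    (hu : IsWeightedHarmonic w u) (hpos : ∀ x, 0 < u x) {x y : Eucl n}
    (hx : ∀ z, w (x + z) = w z) (hy : ∀ z, w (y + z) = w z) : u x ≤ u y := by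
  have key : ∀ r : ℝ, 1 < r → u x ≤ r ^ n * r ^ a * u y := by
    intro r hr
    have hr0 : 0 < r := by linarith
    set C := (1 + 1 / (r ^ 2 - 1)) * ‖x - y‖ ^ 2 with hC
    have hs : ∀ s : ℝ, 0 < s → u x ≤ Real.exp (s * C) * (r ^ n * r ^ a * u y) := by
      intro s hs
      have hrs : 0 < r ^ 2 * s := by positivity
      obtain ⟨i1, e1⟩ := hu.gaussian_mean hw hpos hx hrs
      obtain ⟨i2, e2⟩ := hu.gaussian_mean hw hpos hy hs
      have hle : ∫ z, u z * (w z * Real.exp (-(r ^ 2 * s) * ‖z - x‖ ^ 2)) ≤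
          ∫ z, Real.exp (s * C) * (u z * (w z * Real.exp (-s * ‖z - y‖ ^ 2))) := by
        refine integral_mono i1 (i2.const_mul _) fun z => ?_
        have h1 := norm_sub_sq_le_of_one_lt hr x y z
        have h2 : Real.exp (-(r ^ 2 * s) * ‖z - x‖ ^ 2) ≤
            Real.exp (s * C) * Real.exp (-s * ‖z - y‖ ^ 2) := by
          rw [← Real.exp_add, Real.exp_le_exp]
          nlinarith
        calc u z * (w z * Real.exp (-(r ^ 2 * s) * ‖z - x‖ ^ 2))
            ≤ u z * (w z * (Real.exp (s * C) * Real.exp (-s * ‖z - y‖ ^ 2))) :=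
              mul_le_mul_of_nonneg_left
                (mul_le_mul_of_nonneg_left h2 (hw.nonneg z)) (hpos z).le
          _ = _ := by ring
      rw [integral_const_mul, e1, e2, hw.integral_gaussian_scale hr0 s] at hle
      have hK := hw.integral_gaussian_pos hrs
      refine le_of_mul_le_mul_right (hle.trans_eq ?_) hK
      ring
    -- The limit `s → 0` comes before `r → 1`, since the coefficient in `C` blows up as `r → 1`.
    have hlim : Tendsto (fun s : ℝ => Real.exp (s * C) * (r ^ n * r ^ a * u y)) (𝓝[>] 0)
        (𝓝 (Real.exp (0 * C) * (r ^ n * r ^ a * u y))) :=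
      (Continuous.tendsto (by fun_prop) 0).mono_left nhdsWithin_le_nhds
    have := ge_of_tendsto hlim (eventually_mem_nhdsWithin.mono fun s h => hs s h)
    simpa using this
  have hlim : Tendsto (fun r : ℝ => r ^ n * r ^ a * u y) (𝓝[>] 1)
      (𝓝 (1 ^ n * 1 ^ a * u y)) := by
    refine Tendsto.mono_left (ContinuousAt.tendsto ?_) nhdsWithin_le_nhds
    exact ((continuousAt_id.pow n).mul
      (Real.continuousAt_rpow_const 1 a (Or.inl one_ne_zero))).mul continuousAt_const
  have := ge_of_tendsto hlim (eventually_mem_nhdsWithin.mono fun r h => key r h)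
  simpa using this

/-- A positive solution takes the same value at any two points along which the weight is
translation invariant. -/
theorem IsWeightedHarmonic.eq_of_invariant (hw : IsHomogeneousWeight a w)
    (hu : IsWeightedHarmonic w u) (hpos : ∀ x, 0 < u x) {x y : Eucl n}
    (hx : ∀ z, w (x + z) = w z) (hy : ∀ z, w (y + z) = w z) : u x = u y :=
  le_antisymm (hu.le_of_invariant hw hpos hx hy) (hu.le_of_invariant hw hpos hy hx)

end

/-! ### Gaussians centred on the hyperplane determine finite measures on a half space. -/

section

/-- The closed half space `{z | 0 ≤ σ zₖ}`. -/
def halfSpace {n : ℕ} (k : Fin n) (σ : ℝ) : Set (Eucl n) := {z | 0 ≤ σ * z k}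

lemma isClosed_halfSpace {n : ℕ} (k : Fin n) (σ : ℝ) : IsClosed (halfSpace k σ) :=
  isClosed_le continuous_const (by fun_prop)

/-- The functions `z ↦ exp (⟨b, z⟩ - t |z|²)` with `t > 0` and `b` in the hyperplane `bₖ = 0`,
together with the constant `1`, as functions on a half space. -/
def gaussianMonoid {n : ℕ} (k : Fin n) (σ : ℝ) : Submonoid (halfSpace k σ →ᵇ ℝ) where
  carrier := {g | ∃ (t : ℝ) (b : Eucl n), 0 ≤ t ∧ (t = 0 → b = 0) ∧ b k = 0 ∧
    ∀ z : halfSpace k σ, g z = Real.exp (inner ℝ b (z : Eucl n) - t * ‖(z : Eucl n)‖ ^ 2)}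
  one_mem' := ⟨0, 0, le_rfl, fun _ => rfl, rfl, fun z => by simp⟩
  mul_mem' := by
    rintro g g' ⟨t, b, ht, hb, hk, h⟩ ⟨t', b', ht', hb', hk', h'⟩
    refine ⟨t + t', b + b', by positivity, fun h0 => ?_, by simp [hk, hk'], fun z => ?_⟩
    · rw [hb (by linarith), hb' (by linarith), add_zero]
    · rw [BoundedContinuousFunction.mul_apply, h, h', ← Real.exp_add, inner_add_left]
      ring_nf

/-- The Gaussian `z ↦ exp (⟨b, z⟩ - |z|²)` on a half space. -/
noncomputable def boundedGaussian {n : ℕ} (k : Fin n) (σ : ℝ) (b : Eucl n) :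
    halfSpace k σ →ᵇ ℝ :=
  BoundedContinuousFunction.ofNormedAddCommGroup
    (fun z => Real.exp (inner ℝ b (z : Eucl n) - 1 * ‖(z : Eucl n)‖ ^ 2))
    (by fun_prop) (Real.exp (‖b‖ ^ 2)) (fun z => by
      rw [Real.norm_of_nonneg (Real.exp_pos _).le, Real.exp_le_exp]
      have := real_inner_le_norm b (z : Eucl n)
      nlinarith [sq_nonneg (‖b‖ - ‖(z : Eucl n)‖), sq_nonneg ‖b‖, sq_nonneg ‖(z : Eucl n)‖])

lemma boundedGaussian_mem {n : ℕ} {k : Fin n} {σ : ℝ} {b : Eucl n} (hb : b k = 0) :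
    boundedGaussian k σ b ∈ gaussianMonoid k σ :=
  ⟨1, b, zero_le_one, fun h => absurd h one_ne_zero, hb, fun _ => rfl⟩

/-- `b = 0` detects `|z|` and `b = eᵢ` then detects `zᵢ` for `i ≠ k`, hence `zₖ²`; the half space
fixes the sign. On the whole space, mirror images would not be separated. -/
lemma exists_boundedGaussian_ne {n : ℕ} {k : Fin n} {σ : ℝ} (hσ : σ ≠ 0) {x y : halfSpace k σ}
    (hxy : x ≠ y) : ∃ b : Eucl n, b k = 0 ∧ boundedGaussian k σ b x ≠ boundedGaussian k σ b y := by
  by_contra! H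
  have H' : ∀ b : Eucl n, b k = 0 → inner ℝ b (x : Eucl n) - 1 * ‖(x : Eucl n)‖ ^ 2 =
      inner ℝ b (y : Eucl n) - 1 * ‖(y : Eucl n)‖ ^ 2 := fun b hb => Real.exp_injective (H b hb)
  have hn : ‖(x : Eucl n)‖ ^ 2 = ‖(y : Eucl n)‖ ^ 2 := by simpa using H' 0 rfl
  have hi : ∀ i, i ≠ k → (x : Eucl n) i = (y : Eucl n) i := fun i hik => by
    have := H' (EuclideanSpace.single i 1) (by simp [hik.symm])
    rw [hn] at this
    simpa [EuclideanSpace.inner_single_left] using this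
  have hk : ((x : Eucl n) k) ^ 2 = ((y : Eucl n) k) ^ 2 := by
    rw [EuclideanSpace.real_norm_sq_eq, EuclideanSpace.real_norm_sq_eq,
      ← Finset.add_sum_erase _ _ (Finset.mem_univ k),
      ← Finset.add_sum_erase _ _ (Finset.mem_univ k),
      Finset.sum_congr rfl fun i hi' => by rw [hi i (Finset.ne_of_mem_erase hi')]] at hn
    linarith
  have hk' : (x : Eucl n) k = (y : Eucl n) k := by
    have hx : 0 ≤ σ * (x : Eucl n) k := x.2
    have hy : 0 ≤ σ * (y : Eucl n) k := y.2
    have : σ * (x : Eucl n) k = σ * (y : Eucl n) k :=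
      (pow_left_inj₀ hx hy two_ne_zero).1 (by rw [mul_pow, mul_pow, hk])
    exact mul_left_cancel₀ hσ this
  refine hxy (Subtype.ext (PiLp.ext fun i => ?_))
  by_cases h : i = k
  · rw [h, hk']
  · exact hi i h

/-- The star algebra spanned by the Gaussians with centre on the hyperplane. -/
noncomputable def gaussianAlgebra {n : ℕ} (k : Fin n) (σ : ℝ) :
    StarSubalgebra ℝ (halfSpace k σ →ᵇ ℝ) where
  toSubalgebra := Algebra.adjoin ℝ (gaussianMonoid k σ : Set (halfSpace k σ →ᵇ ℝ))
  star_mem' := fun {g} hg => by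
    have : star g = g := by ext z; simp
    rwa [this]

/-- The Gaussians are closed under products, so the algebra they generate is just their linear span.
-/
lemma gaussianAlgebra_induction {n : ℕ} {k : Fin n} {σ : ℝ} {p : (halfSpace k σ →ᵇ ℝ) → Prop}
    (mem : ∀ g ∈ gaussianMonoid k σ, p g) (zero : p 0) (add : ∀ f g, p f → p g → p (f + g))
    (smul : ∀ (c : ℝ) f, p f → p (c • f)) {g : halfSpace k σ →ᵇ ℝ}
    (hg : g ∈ gaussianAlgebra k σ) : p g := by
  have hg' : g ∈ Submodule.span ℝ (gaussianMonoid k σ : Set (halfSpace k σ →ᵇ ℝ)) := by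
    have : g ∈ Subalgebra.toSubmodule
      (Algebra.adjoin ℝ (gaussianMonoid k σ : Set (halfSpace k σ →ᵇ ℝ))) := hg
    rwa [Algebra.adjoin_eq_span, Submonoid.closure_eq] at this
  exact Submodule.span_induction mem zero (fun f g _ _ => add f g) (fun c f _ => smul c f) hg'

lemma gaussianAlgebra_separatesPoints {n : ℕ} (k : Fin n) {σ : ℝ} (hσ : σ ≠ 0) :
    ((gaussianAlgebra k σ).map (toContinuousMapStarₐ ℝ)).SeparatesPoints := by
  intro x y hxy
  obtain ⟨b, hb, h⟩ := exists_boundedGaussian_ne hσ hxy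
  refine ⟨boundedGaussian k σ b, ⟨(boundedGaussian k σ b).toContinuousMap,
    ⟨boundedGaussian k σ b, Algebra.subset_adjoin (boundedGaussian_mem hb), rfl⟩, rfl⟩, h⟩

/-- Finite measures on a half space are determined by their integrals against Gaussians with
centre on the bounding hyperplane. -/
theorem measure_halfSpace_ext {n : ℕ} {k : Fin n} {σ : ℝ} (hσ : σ ≠ 0)
    {μ ν : Measure (halfSpace k σ)} [IsFiniteMeasure μ] [IsFiniteMeasure ν]
    (h : ∀ g ∈ gaussianMonoid k σ, ∫ z, g z ∂μ = ∫ z, g z ∂ν) : μ = ν := by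
  have : CompleteSpace (halfSpace k σ) := (isClosed_halfSpace k σ).completeSpace_coe
  refine ext_of_forall_mem_subalgebra_integral_eq_of_pseudoEMetric_complete_countable
    (𝕜 := ℝ) (gaussianAlgebra_separatesPoints k hσ) fun g hg => ?_
  refine gaussianAlgebra_induction (p := fun g => ∫ z, g z ∂μ = ∫ z, g z ∂ν) h ?_ ?_ ?_ hg
  · simp
  · intro f g hf hg
    simp only [BoundedContinuousFunction.add_apply]
    rw [integral_add (f.integrable μ) (g.integrable μ),
      integral_add (f.integrable ν) (g.integrable ν), hf, hg]
  · intro c f hf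
    simp only [BoundedContinuousFunction.smul_apply]
    rw [integral_smul, integral_smul, hf]

end

/-! ### From the hyperplane to the half space. -/

section

variable {n : ℕ} {a : ℝ} {w u : Eucl n → ℝ}

/-- The measure with density `φ` on a half space. -/
noncomputable def halfSpaceMeasure (k : Fin n) (σ : ℝ) (φ : Eucl n → ℝ) :
    Measure (halfSpace k σ) :=
  (volume.comap Subtype.val).withDensity fun z => ENNReal.ofReal (φ z)

lemma integral_halfSpaceMeasure {k : Fin n} {σ : ℝ} {φ : Eucl n → ℝ} (hφ : Continuous φ)
    (hφ0 : ∀ z, 0 ≤ φ z) (hφs : ∀ z, z ∉ halfSpace k σ → φ z = 0) (G : Eucl n → ℝ) :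
    ∫ z, G z ∂(halfSpaceMeasure k σ φ) = ∫ z, φ z * G z := by
  unfold halfSpaceMeasure
  rw [integral_withDensity_eq_integral_toReal_smul (by fun_prop)
    (Eventually.of_forall fun z => ENNReal.ofReal_lt_top)]
  simp_rw [ENNReal.toReal_ofReal (hφ0 _), smul_eq_mul]
  rw [integral_subtype_comap (isClosed_halfSpace k σ).measurableSet (fun z => φ z * G z)]
  exact setIntegral_eq_integral_of_forall_compl_eq_zero fun z hz => by rw [hφs z hz, zero_mul]

lemma isFiniteMeasure_halfSpaceMeasure {k : Fin n} {σ : ℝ} {φ : Eucl n → ℝ}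
    (hφ : Integrable φ) : IsFiniteMeasure (halfSpaceMeasure k σ φ) := by
  refine isFiniteMeasure_withDensity_ofReal ?_
  have : Integrable (fun z : halfSpace k σ => φ z) (volume.comap Subtype.val) :=
    (MeasurableEmbedding.subtype_coe (isClosed_halfSpace k σ).measurableSet).integrable_map_iff.1
      (by rw [map_comap_subtype_coe (isClosed_halfSpace k σ).measurableSet]; exact hφ.restrict)
  exact this.2

lemma exp_inner_sub_mul_norm_sq {t : ℝ} (ht : 0 < t) (b z : Eucl n) :
    Real.exp (inner ℝ b z - t * ‖z‖ ^ 2) =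
      Real.exp (‖b‖ ^ 2 / (4 * t)) * Real.exp (-t * ‖z - (2 * t)⁻¹ • b‖ ^ 2) := by
  rw [← Real.exp_add, norm_sub_sq_real, norm_smul, inner_smul_right, real_inner_comm,
    Real.norm_of_nonneg (by positivity)]
  congr 1
  field_simp
  ring

/-- If a positive solution is constant along the bounding hyperplane, and the weight vanishes
off a half space and is invariant along the hyperplane, then the solution is constant on the set
where the weight is positive. -/
theorem IsWeightedHarmonic.eq_of_weight_pos (hw : IsHomogeneousWeight a w)
    (hu : IsWeightedHarmonic w u) (hpos : ∀ x, 0 < u x) {k : Fin n} {σ : ℝ} (hσ : σ ≠ 0)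
    (hws : ∀ z, z ∉ halfSpace k σ → w z = 0) (hwi : ∀ x, x k = 0 → ∀ z, w (x + z) = w z)
    {z : Eucl n} (hz : 0 < w z) : u z = u 0 := by
  have hwc := hw.continuous
  have huc := hu.contDiff.continuous
  have hw0 := hw.nonneg
  set c := u 0 with hc
  have hcpos : 0 < c := hpos 0
  have huconst : ∀ x, x k = 0 → u x = c := fun x hx =>
    hu.eq_of_invariant hw hpos (hwi x hx) (by simp)
  -- The Gaussian factor makes both measures finite.
  set γ : Eucl n → ℝ := fun z => w z * Real.exp (-1 * ‖z‖ ^ 2) with hγ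
  have hγ0 : ∀ z, 0 ≤ γ z := fun z => mul_nonneg (hw0 z) (Real.exp_pos _).le
  have hγc : Continuous γ := by fun_prop
  have hγi : Integrable γ := hw.integrable_mul_gaussian_zero one_pos
  have huγi : Integrable fun z => u z * γ z := by
    simpa [hγ] using (hu.gaussian_mean hw hpos (x₀ := 0) (by simp) one_pos).1
  have hfin1 : IsFiniteMeasure (halfSpaceMeasure k σ fun z => u z * γ z) :=
    isFiniteMeasure_halfSpaceMeasure huγi
  have hfin2 : IsFiniteMeasure (halfSpaceMeasure k σ fun z => c * γ z) :=
    isFiniteMeasure_halfSpaceMeasure (hγi.const_mul c)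
  have int1 := integral_halfSpaceMeasure (k := k) (σ := σ) (φ := fun z => u z * γ z)
    (by fun_prop) (fun z => mul_nonneg (hpos z).le (hγ0 z))
    (fun z hz => by simp [hγ, hws z hz])
  have int2 := integral_halfSpaceMeasure (k := k) (σ := σ) (φ := fun z => c * γ z)
    (by fun_prop) (fun z => mul_nonneg hcpos.le (hγ0 z))
    (fun z hz => by simp [hγ, hws z hz])
  have hμν : (halfSpaceMeasure k σ fun z => u z * γ z) = halfSpaceMeasure k σ fun z => c * γ z := by
    refine measure_halfSpace_ext hσ fun g hg => ?_
    obtain ⟨t, b, ht, -, hbk, hg⟩ := hg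
    simp_rw [hg]
    rw [int1 fun z => Real.exp (inner ℝ b z - t * ‖z‖ ^ 2),
      int2 fun z => Real.exp (inner ℝ b z - t * ‖z‖ ^ 2)]
    -- The factor in `γ` raises `t` to `t + 1`, so even the test function `1` (`t = 0`) becomes a
    -- genuine Gaussian. Completing the square puts its centre `x₀` on the hyperplane.
    have ht1 : 0 < t + 1 := by linarith
    set x₀ := (2 * (t + 1))⁻¹ • b with hx₀
    have hx₀k : x₀ k = 0 := by simp [hx₀, hbk]
    have e : ∀ z, γ z * Real.exp (inner ℝ b z - t * ‖z‖ ^ 2) =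
        Real.exp (‖b‖ ^ 2 / (4 * (t + 1))) * (w z * Real.exp (-(t + 1) * ‖z - x₀‖ ^ 2)) := by
      intro z
      have := exp_inner_sub_mul_norm_sq ht1 b z
      calc γ z * Real.exp (inner ℝ b z - t * ‖z‖ ^ 2)
          = w z * Real.exp (inner ℝ b z - (t + 1) * ‖z‖ ^ 2) := by
            rw [hγ]; dsimp only; rw [mul_assoc, ← Real.exp_add]; ring_nf
        _ = _ := by rw [this]; ring
    simp_rw [mul_assoc, e, mul_left_comm (u _) (Real.exp (‖b‖ ^ 2 / (4 * (t + 1))))]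
    rw [integral_const_mul, integral_const_mul, integral_const_mul,
      (hu.gaussian_mean hw hpos (hwi x₀ hx₀k) ht1).2,
      integral_weight_mul_gaussian (hwi x₀ hx₀k), huconst x₀ hx₀k,
      mul_left_comm]
  -- A bounded test function with the sign of `u - c`: the difference of the two integrals has the
  -- nonnegative integrand `γ (u - c)² / (1 + (u - c)²)`.
  set G : Eucl n → ℝ := fun z => (u z - c) / (1 + (u z - c) ^ 2) with hG
  have hden : ∀ z, 0 < 1 + (u z - c) ^ 2 := fun z => by positivity
  have hGc : Continuous G := by
    refine Continuous.div (by fun_prop) (by fun_prop) fun z => (hden z).ne'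
  have hG1 : ∀ z, ‖G z‖ ≤ 1 := fun z => by
    rw [hG, Real.norm_eq_abs, abs_div, abs_of_pos (hden z), div_le_one (hden z)]
    nlinarith [sq_abs (u z - c), sq_nonneg (|u z - c| - 1), abs_nonneg (u z - c)]
  have i1 : Integrable fun z => u z * γ z * G z :=
    huγi.mul_bdd hGc.aestronglyMeasurable (Eventually.of_forall hG1)
  have i2 : Integrable fun z => c * γ z * G z :=
    (hγi.const_mul c).mul_bdd hGc.aestronglyMeasurable (Eventually.of_forall hG1)
  have hint : ∫ z, (u z * γ z * G z - c * γ z * G z) = 0 := by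
    rw [integral_sub i1 i2, ← int1 G, ← int2 G, hμν, sub_self]
  have e : ∀ z, u z * γ z * G z - c * γ z * G z =
      γ z * ((u z - c) ^ 2 / (1 + (u z - c) ^ 2)) := fun z => by rw [hG]; ring
  have hnn : ∀ z, 0 ≤ u z * γ z * G z - c * γ z * G z := fun z => by
    rw [e]; exact mul_nonneg (hγ0 z) (div_nonneg (sq_nonneg _) (hden z).le)
  have hae := (integral_eq_zero_iff_of_nonneg hnn (i1.sub i2)).1 hint
  have hzero := congrFun ((Continuous.ae_eq_iff_eq volume (by fun_prop)
    continuous_const).1 hae) z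
  rw [e] at hzero
  have hγz : γ z ≠ 0 := (mul_pos hz (Real.exp_pos _)).ne'
  rcases mul_eq_zero.1 hzero with h | h
  · exact absurd h hγz
  · rcases div_eq_zero_iff.1 h with h | h
    · exact sub_eq_zero.1 (pow_eq_zero_iff two_ne_zero |>.1 h)
    · exact absurd h (hden z).ne'

end

/-! ### The equation in coordinates. -/

section

variable {n : ℕ} {a : ℝ} {u : Eucl n → ℝ}

/-- The partial derivative `∂ᵢu`. -/
noncomputable def partialDeriv (i : Fin n) (u : Eucl n → ℝ) (z : Eucl n) : ℝ :=
  fderiv ℝ u z (EuclideanSpace.single i 1)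

/-- The Laplacian as the sum of the pure second partial derivatives. -/
noncomputable def sumPartialDeriv₂ (u : Eucl n → ℝ) (z : Eucl n) : ℝ :=
  ∑ i, partialDeriv i (partialDeriv i u) z

lemma contDiff_partialDeriv (hu : ContDiff ℝ 2 u) (i : Fin n) : ContDiff ℝ 1 (partialDeriv i u) :=
  (hu.fderiv_right (m := 1) (by norm_num)).clm_apply contDiff_const

lemma continuous_partialDeriv₂ (hu : ContDiff ℝ 2 u) (i : Fin n) :
    Continuous (partialDeriv i (partialDeriv i u)) :=
  ((contDiff_partialDeriv hu i).continuous_fderiv one_ne_zero).clm_apply continuous_const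

lemma continuous_sumPartialDeriv₂ (hu : ContDiff ℝ 2 u) : Continuous (sumPartialDeriv₂ u) :=
  continuous_finsetSum _ fun i _ => continuous_partialDeriv₂ hu i

lemma hasLineDerivAt_partialDeriv (hu : ContDiff ℝ 2 u) (i : Fin n) (z : Eucl n) :
    HasLineDerivAt ℝ (partialDeriv i u) (partialDeriv i (partialDeriv i u) z) z
      (EuclideanSpace.single i 1) :=
  ((contDiff_partialDeriv hu i).differentiable one_ne_zero z).hasFDerivAt.hasLineDerivAt _

lemma gradient_apply (u : Eucl n → ℝ) (z : Eucl n) (i : Fin n) :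
    gradient u z i = partialDeriv i u z := by
  have h : inner ℝ (gradient u z) (EuclideanSpace.single i (1 : ℝ)) = partialDeriv i u z := by
    rw [gradient, InnerProductSpace.toDual_symm_apply]; rfl
  rw [EuclideanSpace.inner_single_right] at h
  simpa only [one_mul, conj_trivial] using h

lemma hasDerivAt_abs_rpow_of_ne_zero {s : ℝ} (hs : s ≠ 0) (a : ℝ) :
    HasDerivAt (fun x : ℝ => |x| ^ a) (a * |s| ^ a / s) s := by
  have h := (hasDerivAt_abs hs).rpow_const (p := a) (Or.inl (abs_ne_zero.2 hs))
  have hs' : 0 < |s| := abs_pos.2 hs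
  convert h using 1
  rw [Real.rpow_sub_one hs'.ne']
  rcases lt_or_gt_of_ne hs with h | h
  · simp only [sign_neg h, abs_of_neg h]
    simp
    field_simp
  · simp only [sign_pos h, abs_of_pos h]
    simp
    field_simp

lemma euclideanDivergence_weightedGradient (hu : ContDiff ℝ 2 u) {k : Fin n} {x : Eucl n}
    (hx : x k ≠ 0) : euclideanDivergence (weightedGradient k a u) x =
      |x k| ^ a * (sumPartialDeriv₂ u x + a / x k * partialDeriv k u x) := by
  have hρ : HasFDerivAt (fun y : Eucl n => |y k| ^ a)
      ((a * |x k| ^ a / x k) • (EuclideanSpace.proj k : Eucl n →L[ℝ] ℝ)) x := by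
    have hp : HasFDerivAt (fun y : Eucl n => y k) (EuclideanSpace.proj k : Eucl n →L[ℝ] ℝ) x :=
      (EuclideanSpace.proj k : Eucl n →L[ℝ] ℝ).hasFDerivAt
    have := (hasDerivAt_abs_rpow_of_ne_zero hx a).comp_hasFDerivAt (f := fun y => y k) x hp
    exact this
  have hgrad : DifferentiableAt ℝ (gradient u) x := by
    have : DifferentiableAt ℝ (fderiv ℝ u) x :=
      (hu.fderiv_right (m := 1) (by norm_num)).differentiable one_ne_zero x
    exact (InnerProductSpace.toDual ℝ (Eucl n)).symm.differentiableAt.comp x this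
  have hF : DifferentiableAt ℝ (weightedGradient k a u) x :=
    hρ.differentiableAt.smul hgrad
  have hcomp : ∀ i, fderiv ℝ (weightedGradient k a u) x (EuclideanSpace.single i 1) i =
      |x k| ^ a * partialDeriv i (partialDeriv i u) x +
        partialDeriv i u x * (a * |x k| ^ a / x k * if i = k then 1 else 0) := by
    intro i
    have h1 : HasFDerivAt (fun y => weightedGradient k a u y i)
        ((EuclideanSpace.proj i : Eucl n →L[ℝ] ℝ).comp (fderiv ℝ (weightedGradient k a u) x)) x :=
      (EuclideanSpace.proj i : Eucl n →L[ℝ] ℝ).hasFDerivAt.comp x hF.hasFDerivAt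
    have e : (fun y => weightedGradient k a u y i) = fun y => |y k| ^ a * partialDeriv i u y := by
      funext y
      simp [weightedGradient, gradient_apply]
    rw [e] at h1
    have h2 := hρ.mul ((contDiff_partialDeriv hu i).differentiable one_ne_zero x).hasFDerivAt
    have h3 := congrArg (fun L : Eucl n →L[ℝ] ℝ => L (EuclideanSpace.single i 1)) (h1.unique h2)
    simp only [ContinuousLinearMap.comp_apply, _root_.add_apply, _root_.smul_apply, smul_eq_mul] at h3
    refine h3.trans ?_
    simp [partialDeriv, eq_comm]
  unfold euclideanDivergence sumPartialDeriv₂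
  rw [Finset.sum_congr rfl fun i _ => hcomp i, Finset.sum_add_distrib, ← Finset.mul_sum]
  simp
  ring

lemma eq_zero_of_eq_zero_off_hyperplane {f : Eucl n → ℝ} (hf : Continuous f) {k : Fin n}
    (h : ∀ x, x k ≠ 0 → f x = 0) (x : Eucl n) : f x = 0 := by
  by_cases hx : x k = 0
  · have hc : Continuous fun s : ℝ => f (x + s • EuclideanSpace.single k (1 : ℝ)) := by fun_prop
    have h1 : Tendsto (fun s : ℝ => f (x + s • EuclideanSpace.single k (1 : ℝ))) (𝓝[≠] 0)
        (𝓝 (f x)) := by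
      simpa using (hc.tendsto 0).mono_left (nhdsWithin_le_nhds (s := {0}ᶜ))
    refine tendsto_nhds_unique h1 (tendsto_const_nhds.congr' ?_)
    filter_upwards [self_mem_nhdsWithin] with s hs
    exact (h _ (by simpa [hx] using hs)).symm
  · exact h x hx

lemma IsC2WeightedSolution.sumPartialDeriv₂_add_eq_zero {k : Fin n}
    (hu : IsC2WeightedSolution k a u) {x : Eucl n} (hx : x k ≠ 0) :
    sumPartialDeriv₂ u x + a / x k * partialDeriv k u x = 0 := by
  have h := hu.div_eq_zero x hx
  rw [euclideanDivergence_weightedGradient hu.contDiff hx] at h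
  exact (mul_eq_zero.1 h).resolve_left (Real.rpow_pos_of_pos (abs_pos.2 hx) a).ne'

/-- Multiplying by `x k` removes the singularity, so the equation extends by continuity. On the
hyperplane it gives `∂ₖu = 0` when `a ≠ 0`. -/
lemma IsC2WeightedSolution.coord_mul_sumPartialDeriv₂ {k : Fin n}
    (hu : IsC2WeightedSolution k a u) (x : Eucl n) :
    x k * sumPartialDeriv₂ u x + a * partialDeriv k u x = 0 := by
  have hc1 := continuous_sumPartialDeriv₂ hu.contDiff
  have hc2 := (contDiff_partialDeriv hu.contDiff k).continuous
  refine eq_zero_of_eq_zero_off_hyperplane (k := k)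
    (f := fun x => x k * sumPartialDeriv₂ u x + a * partialDeriv k u x) (by fun_prop) ?_ x
  intro x hx
  have h := hu.sumPartialDeriv₂_add_eq_zero hx
  have : x k * sumPartialDeriv₂ u x + a * partialDeriv k u x =
    x k * (sumPartialDeriv₂ u x + a / x k * partialDeriv k u x) := by field_simp
  simp only [this, h, mul_zero]

/-! ### The constant weight, the half-space weights, and the conclusion. -/

lemma isHomogeneousWeight_one : IsHomogeneousWeight 0 (fun _ : Eucl n => (1 : ℝ)) where
  continuous := continuous_const
  nonneg _ := zero_le_one
  smul t _ z := by simp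
  le_norm z := by nlinarith [sq_nonneg ‖z‖]
  exists_pos := ⟨0, one_pos⟩

lemma IsC2WeightedSolution.isWeightedHarmonic_one {k : Fin n}
    (hu : IsC2WeightedSolution k 0 u) : IsWeightedHarmonic (fun _ => 1) u where
  contDiff := hu.contDiff.of_le (by norm_num)
  exists_div := by
    refine ⟨fun i => partialDeriv i (partialDeriv i u),
      fun i => continuous_partialDeriv₂ hu.contDiff i, fun i z => ?_, fun z => ?_⟩
    · simp only [one_mul]
      exact hasLineDerivAt_partialDeriv hu.contDiff i z
    · refine eq_zero_of_eq_zero_off_hyperplane (k := k)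
        (continuous_sumPartialDeriv₂ hu.contDiff) (fun x hx => ?_) z
      simpa using hu.sumPartialDeriv₂_add_eq_zero hx

/-- The weight `(σ zₖ)₊ᵃ` supported on a half space. -/
noncomputable def halfWeight (k : Fin n) (σ a : ℝ) (z : Eucl n) : ℝ := (max (σ * z k) 0) ^ a

lemma continuous_halfWeight (k : Fin n) (σ : ℝ) (ha : 0 ≤ a) :
    Continuous (halfWeight k σ a) := by
  unfold halfWeight
  exact (by fun_prop : Continuous fun z : Eucl n => max (σ * z k) 0).rpow_const
    fun _ => Or.inr ha

lemma isHomogeneousWeight_halfWeight (k : Fin n) {σ : ℝ} (hσ : |σ| = 1) (ha : 0 ≤ a)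
    (ha2 : a ≤ 2) : IsHomogeneousWeight a (halfWeight k σ a) where
  continuous := continuous_halfWeight k σ ha
  nonneg z := by unfold halfWeight; positivity
  smul t ht z := by
    unfold halfWeight
    rw [← Real.mul_rpow ht.le (le_max_right _ _), mul_max_of_nonneg _ _ ht.le]
    simp [mul_left_comm]
  le_norm z := by
    unfold halfWeight
    have h0 : 0 ≤ max (σ * z k) 0 := le_max_right _ _
    have h1 : max (σ * z k) 0 ≤ ‖z‖ := by
      refine max_le ((le_abs_self _).trans ?_) (norm_nonneg z)
      rw [abs_mul, hσ, one_mul]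
      exact PiLp.norm_apply_le z k
    refine (Real.rpow_le_rpow h0 h1 ha).trans ?_
    rcases le_total ‖z‖ 1 with h | h
    · have := Real.rpow_le_one (norm_nonneg z) h ha
      nlinarith [sq_nonneg ‖z‖]
    · have := Real.rpow_le_rpow_of_exponent_le h ha2
      rw [Real.rpow_two] at this
      linarith
  exists_pos := by
    refine ⟨EuclideanSpace.single k σ, ?_⟩
    have : σ * σ = 1 := by rw [← abs_mul_abs_self, hσ, one_mul]
    simp [halfWeight, this]

lemma halfWeight_add_single_of_ne {k i : Fin n} (h : i ≠ k) (σ : ℝ) (z : Eucl n) (s : ℝ) :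
    halfWeight k σ a (z + s • EuclideanSpace.single i (1 : ℝ)) = halfWeight k σ a z := by
  simp [halfWeight, h.symm]

/-- The equation turns the singular term `a w ∂ₖu / zₖ` into `-w Δu`, which is continuous. On the
hyperplane the weight need not be differentiable, but `∂ₖu` vanishes there. -/
lemma IsC2WeightedSolution.hasLineDerivAt_halfWeight_mul {k : Fin n} (ha : 0 < a)
    (hu : IsC2WeightedSolution k a u) {σ : ℝ} (hσ : |σ| = 1) (z : Eucl n) :
    HasLineDerivAt ℝ (fun y => halfWeight k σ a y * partialDeriv k u y)
      (halfWeight k σ a z * (partialDeriv k (partialDeriv k u) z - sumPartialDeriv₂ u z)) z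
      (EuclideanSpace.single k 1) := by
  have hD : HasDerivAt (fun s : ℝ => partialDeriv k u (z + s • EuclideanSpace.single k 1))
    (partialDeriv k (partialDeriv k u) z) 0 := hasLineDerivAt_partialDeriv hu.contDiff k z
  have hE := hu.coord_mul_sumPartialDeriv₂ z
  have hσ0 : σ ≠ 0 := fun h => by simp [h] at hσ
  have hWc : Continuous fun s : ℝ => halfWeight k σ a (z + s • EuclideanSpace.single k 1) :=
    (continuous_halfWeight k σ ha.le).comp (by fun_prop)
  have haff : ∀ s : ℝ, σ * (z + s • EuclideanSpace.single k (1 : ℝ) : Eucl n) k = σ * z k + s * σ :=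
    fun s => by simp; ring
  have hac : Continuous fun s : ℝ => σ * z k + s * σ := by fun_prop
  unfold HasLineDerivAt
  rcases lt_trichotomy (σ * z k) 0 with h | h | h
  · rw [halfWeight, max_eq_right h.le, Real.zero_rpow ha.ne', zero_mul]
    refine (hasDerivAt_const (0 : ℝ) (0 : ℝ)).congr_of_eventuallyEq ?_
    filter_upwards [(hac.tendsto 0).eventually_lt_const (u := 0) (by simpa using h)] with s hs
    rw [halfWeight, haff, max_eq_right hs.le, Real.zero_rpow ha.ne', zero_mul]
  · have hz : z k = 0 := (mul_eq_zero.1 h).resolve_left hσ0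
    have hD0 : partialDeriv k u z = 0 := by
      rw [hz, zero_mul, zero_add] at hE
      exact (mul_eq_zero.1 hE).resolve_left ha.ne'
    have := hasDerivAt_mul_of_eq_zero hWc.continuousAt hD (by simpa using hD0)
    rw [zero_smul, add_zero, show halfWeight k σ a z = 0 by simp [halfWeight, h, ha.ne'],
      zero_mul] at this
    rwa [show halfWeight k σ a z = 0 by simp [halfWeight, h, ha.ne'], zero_mul]
  · have h1 : HasDerivAt (fun s : ℝ => σ * z k + s * σ) σ 0 := by
      simpa using ((hasDerivAt_id (0 : ℝ)).mul_const σ).const_add (σ * z k)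
    have h2 := h1.rpow_const (p := a) (Or.inl (by simpa using h.ne'))
    have h3 := h2.mul hD
    simp only [zero_mul, add_zero, zero_smul] at h3
    have hval : halfWeight k σ a z * (partialDeriv k (partialDeriv k u) z - sumPartialDeriv₂ u z) =
        σ * a * (σ * z k) ^ (a - 1) * partialDeriv k u z +
          (σ * z k) ^ a * partialDeriv k (partialDeriv k u) z := by
      rw [halfWeight, max_eq_left h.le, Real.rpow_sub_one h.ne']
      have hz : z k ≠ 0 := fun h' => by simp [h'] at h
      field_simp
      linear_combination (-1 : ℝ) * hE
    rw [hval]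
    refine h3.congr_of_eventuallyEq ?_
    filter_upwards [(hac.tendsto 0).eventually_const_lt (u := 0) (by simpa using h)] with s hs
    simp only [Pi.mul_apply]
    rw [halfWeight, haff, max_eq_left hs.le]

lemma IsC2WeightedSolution.isWeightedHarmonic_halfWeight {k : Fin n} (ha : 0 < a)
    (hu : IsC2WeightedSolution k a u) {σ : ℝ} (hσ : |σ| = 1) :
    IsWeightedHarmonic (halfWeight k σ a) u where
  contDiff := hu.contDiff.of_le (by norm_num)
  exists_div := by
    -- Only direction `k` differentiates the weight; its correction `-w Δu` cancels the sum of the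
    -- terms `w ∂ᵢᵢu`.
    refine ⟨fun i z => halfWeight k σ a z * (partialDeriv i (partialDeriv i u) z -
      if i = k then sumPartialDeriv₂ u z else 0), fun i => ?_, fun i z => ?_, fun z => ?_⟩
    · have h1 := continuous_halfWeight (a := a) k σ ha.le
      have h2 := continuous_partialDeriv₂ hu.contDiff i
      have h3 := continuous_sumPartialDeriv₂ hu.contDiff
      dsimp only
      split_ifs <;> fun_prop
    · by_cases h : i = k
      · subst h
        simp only [if_true]
        exact hu.hasLineDerivAt_halfWeight_mul ha hσ z
      · have h1 := hasLineDerivAt_partialDeriv hu.contDiff i z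
        unfold HasLineDerivAt at h1 ⊢
        simp only [halfWeight_add_single_of_ne h, if_neg h, sub_zero]
        exact h1.const_mul _
    · rw [← Finset.mul_sum, Finset.sum_sub_distrib]
      simp [sumPartialDeriv₂]

lemma IsC2WeightedSolution.eq_apply_zero {k : Fin n} (ha : 0 < a) (ha2 : a ≤ 2)
    (hu : IsC2WeightedSolution k a u) (hpos : ∀ x, 0 < u x) (z : Eucl n) : u z = u 0 := by
  have hinv : ∀ σ : ℝ, ∀ x : Eucl n, x k = 0 → ∀ y,
      halfWeight k σ a (x + y) = halfWeight k σ a y := fun σ x hx y => by simp [halfWeight, hx]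
  have half : ∀ σ : ℝ, |σ| = 1 → 0 < σ * z k → u z = u 0 := fun σ hσ hz => by
    refine (hu.isWeightedHarmonic_halfWeight ha hσ).eq_of_weight_pos (k := k) (σ := σ)
      (isHomogeneousWeight_halfWeight k hσ ha.le ha2) hpos (fun h => by simp [h] at hσ)
      (fun y hy => ?_) (hinv σ) ?_
    · rw [halfWeight, max_eq_right (not_le.1 hy).le, Real.zero_rpow ha.ne']
    · rw [halfWeight, max_eq_left hz.le]
      positivity
  rcases lt_trichotomy (z k) 0 with h | h | h
  · exact half (-1) (by simp) (by linarith)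
  · exact (hu.isWeightedHarmonic_halfWeight ha (σ := 1) (by simp)).eq_of_invariant
      (isHomogeneousWeight_halfWeight k (by simp) ha.le ha2) hpos (hinv 1 z h) (by simp)
  · exact half 1 (by simp) (by linarith)

end

theorem corollary1p4 (n : ℕ) (hn : 2 ≤ n) (a : ℝ) (ha0 : 0 ≤ a) (ha1 : a < 1)
    (u : EuclideanSpace ℝ (Fin n) → ℝ)
    (hu : IsC2WeightedSolution (⟨n - 1, by omega⟩ : Fin n) a u)
    (hpos : ∀ x, 0 < u x) :
    ∃ c : ℝ, ∀ x, u x = c := by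
  refine ⟨u 0, fun x => ?_⟩
  -- At `a = 0` the half-space weight would be identically `1`, as `0 ^ 0 = 1`, and so not
  -- one-sided; but the weight `1` is invariant under all translations.
  rcases ha0.eq_or_lt with rfl | ha
  · exact hu.isWeightedHarmonic_one.eq_of_invariant isHomogeneousWeight_one hpos
      (fun _ => rfl) (fun _ => rfl)
  · exact hu.eq_apply_zero ha (by linarith) hpos x
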